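/- Let $X=\{0,1\}^{\mathbb N}$ be the space of infinite $0,1$-sequences and let $\mu=\nu^{\otimes\infty}$ be the product measure on $X$ with $\nu(\{0\})=\nu(\{1\})=1/2$. For $n\in\mathbb N$ let $X_n=\{0,1\}^n$, and let the group $S(2^n)$ of all permutations of $X_n$ act on $X$ by $s((x,a))=(s(x),a)$ for $x\in X_n$, $a\in X$. Regarding each $S(2^n)$ as a group of bijections of $X$, put $S(2^\infty)=\bigcup_n S(2^n)$; this is an increasing union of groups. For $s\in S(2^\infty)$ let $\mathrm{Fix}(s)=\{x\in X: s(x)=x\}$. A character on a group $G$ is a function $\chi:G\to\mathbb C$ such that $\chi(g_1g_2)=\chi(g_2g_1)$ for all $g_1,g_2\in G$; the matrix $\{\chi(g_ig_j^{-1})\}_{i,j=1}^n$ is positive semidefinite for all $n$ and all $g_1,\dots,g_n\in G$; and $\chi(e)=1$. A character $\chi$ is called indecomposable if it cannot be written as $\chi=t\chi_1+(1-t)\chi_2$ with $0<t<1$ and $\chi_1,\chi_2$ distinct characters on $G$. Theorem. A function $\chi:S(2^\infty)\to\mathbb C$ is an indecomposable character if and only if there exists $\alpha\in\{0,1,2,\dots\}\cup\{\infty\}$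 such that $$\chi(s)=\mu(\mathrm{Fix}(s))^\alpha\quad\text{for all } s\in S(2^\infty),$$ where $0^0=1$, $x^\infty=0$ for $x\in[0,1)$, and $1^\infty=1$. -/

import Mathlib

open scoped ComplexOrder

noncomputable section

namespace CantorPerm

/-- The space of all infinite `0,1`-sequences. -/
abbrev X : Type := ℕ → Bool

/-- The set of `0,1`-sequences of length `n`. -/
abbrev Xn (n : ℕ) : Type := Fin n → Bool

/-- The concatenation `(x, a)` of a finite sequence `x` and an infinite sequence `a`. -/
def cat {n : ℕ} (x : Xn n) (a : X) : X :=
  fun k => if h : k < n then x ⟨k, h⟩ else a (k - n)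

/-- Every infinite sequence is uniquely of the form `(x, a)` with `x` of length `n`. -/
def catEquiv (n : ℕ) : Xn n × X ≃ X where
  toFun p := cat p.1 p.2
  invFun y := (fun i => y i, fun k => y (n + k))
  left_inv p := by
    refine Prod.ext ?_ ?_
    · funext i
      simp [cat]
    · funext k
      simp [cat]
  right_inv y := by
    funext k
    by_cases h : k < n
    · simp [cat, h]
    · simp [cat, h, Nat.add_sub_cancel' (not_lt.mp h)]

/-- The natural action of the permutations of `Xn n` on `X`: `s (x, a) = (s x, a)`. -/
def act (n : ℕ) : Equiv.Perm (Xn n) →* Equiv.Perm X where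
  toFun s := (catEquiv n).permCongr (s.prodCongr (Equiv.refl X))
  map_one' := by
    ext1 y
    simp [Equiv.permCongr_apply]
  map_mul' s t := by
    ext1 y
    simp [Equiv.permCongr_apply, Prod.map]

theorem act_cat {n : ℕ} (s : Equiv.Perm (Xn n)) (x : Xn n) (a : X) :
    act n s (cat x a) = cat (s x) a := by
  have h : (catEquiv n).symm (cat x a) = (x, a) := (catEquiv n).symm_apply_apply (x, a)
  change catEquiv n (s.prodCongr (Equiv.refl X) ((catEquiv n).symm (cat x a))) = cat (s x) a
  rw [h]
  rfl

/-- The group `S(2^n)`, realized by its action on `X`. -/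
def level (n : ℕ) : Subgroup (Equiv.Perm X) := (act n).range

theorem mem_level_iff {n : ℕ} {g : Equiv.Perm X} :
    g ∈ level n ↔ ∃ s : Equiv.Perm (Xn n), ∀ (x : Xn n) (a : X), g (cat x a) = cat (s x) a := by
  constructor
  · rintro ⟨s, rfl⟩
    exact ⟨s, act_cat s⟩
  · rintro ⟨s, hs⟩
    refine ⟨s, Equiv.ext fun y => ?_⟩
    obtain ⟨⟨x, a⟩, rfl⟩ := (catEquiv n).surjective y
    exact (act_cat s x a).trans (hs x a).symm

theorem level_le_succ (n : ℕ) : level n ≤ level (n + 1) := by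
  rintro g ⟨s, rfl⟩
  let e : Xn n × Bool ≃ Xn (n + 1) := (Equiv.prodComm _ _).trans (Fin.snocEquiv fun _ => Bool)
  have key : ∀ (x : Xn n) (b : Bool) (a : X),
      cat (e (x, b)) a = cat x (fun k => if h : k = 0 then b else a (k - 1)) := by
    intro x b a
    funext k
    rcases lt_trichotomy k n with h | h | h
    · simp [e, cat, h, Nat.lt_succ_of_lt h, Fin.snocEquiv, Fin.snoc]
    · subst h
      simp [e, cat, Fin.snocEquiv, Fin.snoc]
    · have h1 : ¬ k < n := by omega
      have h2 : ¬ k < n + 1 := by omega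
      have h3 : ¬ k - n = 0 := by omega
      simp only [cat, h1, h2, h3, dite_false]
      congr 1
  refine mem_level_iff.2 ⟨e.permCongr (s.prodCongr (Equiv.refl Bool)), fun x a => ?_⟩
  obtain ⟨⟨x, b⟩, rfl⟩ := e.surjective x
  have h : e.permCongr (s.prodCongr (Equiv.refl Bool)) (e (x, b)) = e (s x, b) := by
    simp [Equiv.permCongr_apply]
  rw [h, key, key, act_cat]

theorem level_mono : Monotone level := monotone_nat_of_le_succ level_le_succ

/-- The group `S(2^∞)`, the union of the increasing sequence of groups `S(2^n)`. -/
def SInf : Subgroup (Equiv.Perm X) where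
  carrier := ⋃ n : ℕ, (level n : Set (Equiv.Perm X))
  one_mem' := Set.mem_iUnion.2 ⟨0, (level 0).one_mem⟩
  mul_mem' := by
    intro g h hg hh
    obtain ⟨n, hn⟩ := Set.mem_iUnion.1 hg
    obtain ⟨m, hm⟩ := Set.mem_iUnion.1 hh
    exact Set.mem_iUnion.2 ⟨max n m, (level (max n m)).mul_mem
      (level_mono (le_max_left n m) hn) (level_mono (le_max_right n m) hm)⟩
  inv_mem' := by
    intro g hg
    obtain ⟨n, hn⟩ := Set.mem_iUnion.1 hg
    exact Set.mem_iUnion.2 ⟨n, (level n).inv_mem hn⟩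

/-- The product measure on `X` whose factors give mass `1/2` to each of the two symbols. -/
def bernoulliMeasure : MeasureTheory.Measure X :=
  MeasureTheory.Measure.infinitePi fun _ : ℕ => (PMF.uniformOfFintype Bool).toMeasure

/-- The fixed point set of a permutation of `X`. -/
def Fix (s : Equiv.Perm X) : Set X := {x | s x = x}

/-- The power `x ^ α` for `α ∈ {0, 1, 2, …} ∪ {∞}` and `x ∈ [0, 1]`, with `0 ^ 0 = 1`,
`x ^ ∞ = 0` for `x < 1` and `1 ^ ∞ = 1`. -/
def epow (x : ℝ) (α : ℕ∞) : ℝ :=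
  if α = ⊤ then (if x = 1 then 1 else 0) else x ^ α.toNat

end CantorPerm

/-- A character on a group: a central, positive definite, normalized function. -/
structure IsCharacter {G : Type*} [Group G] (χ : G → ℂ) : Prop where
  central : ∀ g h : G, χ (g * h) = χ (h * g)
  posSemidef : ∀ (n : ℕ) (g : Fin n → G),
    (Matrix.of fun i j : Fin n => χ (g i * (g j)⁻¹)).PosSemidef
  map_one : χ 1 = 1

/-- A character which is not a proper convex combination of two distinct characters. -/
def IsIndecomposableCharacter {G : Type*} [Group G] (χ : G → ℂ) : Prop :=
  IsCharacter χ ∧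
    ¬ ∃ (t : ℝ) (χ₁ χ₂ : G → ℂ), 0 < t ∧ t < 1 ∧ IsCharacter χ₁ ∧ IsCharacter χ₂ ∧ χ₁ ≠ χ₂ ∧
      ∀ g : G, χ g = (t : ℂ) * χ₁ g + (1 - (t : ℂ)) * χ₂ g

end

/-! A character gives vectors `ξ_g` in a Hilbert space with inner products `χ (g * h⁻¹)`. The first
point is that `χ` sees only `μ(Fix s)`. Lift `s` to a product with a large finite set `Bool × F`.
There, `|F|` conjugates `h_b` of `s` and `|F|` involutions `t_b`, fixing exactly the points over the
fixed points of `s`, can be chosen so that all quotients of distinct members are again such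
involutions. These form one conjugacy class, on which `χ` has a constant value `c`. Cauchy–Schwarz
for `ξ_1` and `∑ (ξ_{t_b} - ξ_{h_b})` gives `|F| |c - χ(s)|² ≤ 2 (1 - Re c) ≤ 4`
(`IsCharacter.card_mul_normSq_le`, `card_mul_normSq_exchange_sub_le`). Involutions with equally many
fixed points are conjugate, so letting `|F| → ∞` proves `apply_eq_of_fixRatio_eq`.

Thus `χ = f(μ(Fix s))` with `f` real. Positivity on commuting fibre translations makes the forward
differences of `k ↦ f(k / 2^n)` at `0` nonnegative (`fwdDiff_iter_nonneg`). Newton's formula then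
writes `f(k / 2^n)` as an average of the ratios `C(k,j) / C(2^n,j)`, which tend to `x^j` when `k /
2^n = x`. In the limit `f(x) = ∑ p_j x^j` for `x < 1`, with `p_j ≥ 0`; mass lost to `j = ∞` is the
weight of `α = ∞`. So every character is a countable mixture of the powers
(`exists_hasSum_powChar`), and an indecomposable one is a single power.

Conversely, fixed-point counts are Gram matrices, so the powers are characters. Comparing orders of
vanishing as `x → 0` shows that a power has only the trivial mixture representation
(`weight_eq_zero`). -/

noncomputable section

/-! ### Positivity and a Cauchy–Schwarz estimate for characters -/

namespace IsCharacter

variable {G : Type*} [Group G] {χ : G → ℂ}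

theorem sum_nonneg (hχ : IsCharacter χ) {ι : Type*} [Fintype ι] (g : ι → G) (a : ι → ℂ) :
    0 ≤ ∑ i, ∑ j, star (a i) * χ (g i * (g j)⁻¹) * a j := by
  classical
  let e := Fintype.equivFin ι
  have h := (hχ.posSemidef _ (g ∘ e.symm)).dotProduct_mulVec_nonneg (a ∘ e.symm)
  simp only [dotProduct, Matrix.mulVec, Matrix.of_apply, Function.comp_apply, Pi.star_apply,
    Finset.mul_sum] at h
  rw [← e.symm.sum_comp]
  refine h.trans_eq (Finset.sum_congr rfl fun i _ => ?_)
  rw [← e.symm.sum_comp]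
  exact Finset.sum_congr rfl fun j _ => (mul_assoc _ _ _).symm

theorem map_inv (hχ : IsCharacter χ) (g : G) : χ g⁻¹ = star (χ g) := by
  have h := (hχ.posSemidef 2 ![g, 1]).isHermitian.apply 1 0
  simpa using h.symm

theorem map_conj (hχ : IsCharacter χ) {g h : G} (H : IsConj g h) : χ g = χ h := by
  obtain ⟨c, rfl⟩ := isConj_iff.1 H
  rw [hχ.central (c * g) c⁻¹]
  simp

theorem neg_one_le_re (hχ : IsCharacter χ) (g : G) : -1 ≤ (χ g).re := by
  have h := hχ.sum_nonneg ![g, 1] ![1, 1]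
  have h' := (Complex.le_def.1 h).1
  simp [Fin.sum_univ_two, hχ.map_one, hχ.map_inv] at h'
  linarith

theorem comp (hχ : IsCharacter χ) {H : Type*} [Group H] (φ : H →* G) :
    IsCharacter fun h => χ (φ h) where
  central g h := by simpa using hχ.central (φ g) (φ h)
  posSemidef n g := by simpa using hχ.posSemidef n fun i => φ (g i)
  map_one := by simpa using hχ.map_one

theorem of_sum_nonneg (central : ∀ g h : G, χ (g * h) = χ (h * g))
    (map_inv : ∀ g, χ g⁻¹ = star (χ g))
    (nonneg : ∀ (n : ℕ) (g : Fin n → G) (a : Fin n → ℂ),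
      0 ≤ ∑ i, ∑ j, star (a i) * χ (g i * (g j)⁻¹) * a j)
    (map_one : χ 1 = 1) : IsCharacter χ where
  central := central
  map_one := map_one
  posSemidef n g := by
    refine Matrix.PosSemidef.of_dotProduct_mulVec_nonneg ?_ fun a => ?_
    · ext i j
      rw [Matrix.conjTranspose_apply, Matrix.of_apply, Matrix.of_apply, ← map_inv]
      simp
    · simpa [dotProduct, Matrix.mulVec, Finset.mul_sum, mul_assoc] using nonneg n g a

/-- Two families of group elements whose mutual quotients all have character value `c`
force the values of `χ` on them to be close. -/
theorem card_mul_normSq_le (hχ : IsCharacter χ) {F : Type*} [Fintype F] [Nonempty F] [DecidableEq F]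
    (t h : F → G) {c d : ℂ} (hc : star c = c)
    (htt : ∀ a b, a ≠ b → χ (t a * (t b)⁻¹) = c) (hhh : ∀ a b, a ≠ b → χ (h a * (h b)⁻¹) = c)
    (hht : ∀ a b, χ (h a * (t b)⁻¹) = c) (ht : ∀ a, χ (t a) = c) (hh : ∀ a, χ (h a) = d) :
    Fintype.card F * Complex.normSq (c - d) ≤ 2 * (1 - c.re) := by
  set N : ℂ := (Fintype.card F : ℂ) with hN
  -- The coefficient of the identity that minimises the quadratic form; with `1` on the `t a` and
  -- `-1` on the `h a` it turns positivity into Cauchy–Schwarz. The off-diagonal values `c` cancel,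
  -- leaving `2 * N * (1 - c)`.
  set l : ℂ := -N * star (c - d)
  have hth : ∀ a b, χ (t a * (h b)⁻¹) = c := fun a b => by
    rw [← hc, ← hht b a, ← hχ.map_inv]; simp
  have htt' : ∀ a b, χ (t a * (t b)⁻¹) = c + if a = b then 1 - c else 0 := fun a b => by
    split_ifs with hab
    · simp [hab, hχ.map_one]
    · simp [htt a b hab]
  have hhh' : ∀ a b, χ (h a * (h b)⁻¹) = c + if a = b then 1 - c else 0 := fun a b => by
    split_ifs with hab
    · simp [hab, hχ.map_one]
    · simp [hhh a b hab]
  have key := hχ.sum_nonneg (ι := Option (F ⊕ F))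
    (fun i => i.elim 1 (Sum.elim t h)) (fun i => i.elim l (Sum.elim 1 (-1)))
  have hNr : star N = N := by simp [hN]
  have hsum : star l * l + 2 * N * (1 - c) + N * star l * star (c - d) + N * l * (c - d) =
      N * (2 * (1 - c) - N * (star (c - d) * (c - d))) := by
    simp only [l, star_mul, star_neg, hNr, star_star]
    ring
  have key2 : 0 ≤ N * (2 * (1 - c) - N * (star (c - d) * (c - d))) := by
    rw [← hsum]
    refine key.trans_eq ?_
    simp only [Fintype.sum_option, Fintype.sum_sum_type, Option.elim, Sum.elim_inl, Sum.elim_inr,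
      inv_one, mul_one, one_mul, hχ.map_inv, hχ.map_one, ht, hh, hth, hht, htt', hhh', hc,
      Pi.one_apply, Pi.neg_apply, star_one, star_neg, neg_mul, mul_neg,
      Finset.sum_const, Finset.sum_add_distrib, Finset.sum_neg_distrib, Finset.card_univ,
      Finset.sum_ite_eq, Finset.mem_univ, if_true, nsmul_eq_mul, ← hN, star_sub]
    ring
  have hpos : (0 : ℝ) < Fintype.card F := by exact_mod_cast Fintype.card_pos
  have hconv : N * (2 * (1 - c) - N * (star (c - d) * (c - d))) =
      (Fintype.card F : ℝ) • (2 * (1 - c) - ((Fintype.card F * Complex.normSq (c - d) : ℝ) : ℂ)) := by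
    rw [Complex.real_smul, Complex.ofReal_mul, Complex.normSq_eq_conj_mul_self]
    rfl
  rw [hconv] at key2
  have h1 := (Complex.le_def.1 key2).1
  rw [Complex.smul_re, Complex.zero_re, smul_eq_mul] at h1
  have h2 := nonneg_of_mul_nonneg_right h1 hpos
  simp only [Complex.sub_re, Complex.mul_re, Complex.re_ofNat, Complex.im_ofNat, Complex.one_re,
    Complex.ofReal_re, zero_mul, sub_zero] at h2
  linarith

end IsCharacter

/-! ### Finite levels, product actions and fixed-point ratios -/

namespace CantorPerm

open Equiv

/-- The embedding of `S(2^n)` into `S(2^∞)`. -/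
def toSInf (n : ℕ) : Perm (Xn n) →* SInf :=
  (act n).codRestrict SInf fun s => Set.mem_iUnion.2 ⟨n, s, rfl⟩

theorem exists_toSInf_eq (g : SInf) : ∃ n, ∀ m, n ≤ m → ∃ s, toSInf m s = g := by
  obtain ⟨n, hn⟩ := Set.mem_iUnion.1 g.2
  refine ⟨n, fun m hm => ?_⟩
  obtain ⟨s, hs⟩ := level_mono hm hn
  exact ⟨s, Subtype.ext hs⟩

theorem exists_toSInf_eq_of_finite {ι : Type*} [Finite ι] (g : ι → SInf) :
    ∃ n, ∀ i, ∃ s, toSInf n s = g i := by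
  cases nonempty_fintype ι
  choose n hn using fun i => exists_toSInf_eq (g i)
  exact ⟨Finset.univ.sup n, fun i => hn i _ (Finset.le_sup (Finset.mem_univ i))⟩

/-- The action of the permutations of `Xn n × Y` on `X`, for a set `Y` identified with `Xn j`. -/
def prodAct (n : ℕ) {j : ℕ} {Y : Type*} (e : Y ≃ Xn j) : Perm (Xn n × Y) →* SInf :=
  (toSInf (n + j)).comp
    (((Equiv.refl _).prodCongr e).trans (Fin.appendEquiv n j)).permCongrHom.toMonoidHom

theorem cat_append {n j : ℕ} (x : Xn n) (y : Xn j) (a : X) :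
    cat (Fin.append x y) a = cat x (cat y a) := by
  funext k
  by_cases h : k < n
  · have h' : k < n + j := by omega
    simp only [cat, h, h', dif_pos]
    exact Fin.append_left x y ⟨k, h⟩
  · by_cases h' : k < n + j
    · have h2 : k - n < j := by omega
      simp only [cat, h, h', h2, dif_pos, dif_neg, not_false_eq_true]
      convert Fin.append_right x y ⟨k - n, h2⟩ using 2
      ext; simp; omega
    · have h2 : ¬ k - n < j := by omega
      simp only [cat, h, h', h2, dif_neg, not_false_eq_true]
      congr 1; omega

theorem prodAct_prodCongr (n : ℕ) {j : ℕ} {Y : Type*} (e : Y ≃ Xn j) (s : Perm (Xn n)) :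
    prodAct n e (s.prodCongr (Equiv.refl Y)) = toSInf n s := by
  refine Subtype.ext (Equiv.ext fun w => ?_)
  obtain ⟨⟨x, b⟩, rfl⟩ := (catEquiv n).surjective w
  obtain ⟨⟨y, a⟩, rfl⟩ := (catEquiv j).surjective b
  change act (n + j) _ (cat x (cat y a)) = act n s (cat x (cat y a))
  rw [act_cat, ← cat_append, act_cat, ← cat_append]
  congr 1
  have : Fin.append x y = ((Equiv.refl _).prodCongr e).trans (Fin.appendEquiv n j)
    (x, e.symm y) := by
    simp [Fin.appendEquiv]
  rw [this]
  simp [Equiv.permCongrHom, Fin.appendEquiv]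

theorem measureReal_cylinder {n : ℕ} (x : Xn n) :
    bernoulliMeasure.real {w : X | ∀ i : Fin n, w i = x i} = (1 / 2) ^ n := by
  have h : {w : X | ∀ i : Fin n, w i = x i} =
      Set.pi (Finset.range n) fun k => {cat x (fun _ => false) k} := by
    ext w
    simp only [Set.mem_ofPred_eq, Set.mem_pi, Finset.coe_range, Set.mem_Iio, Set.mem_singleton_iff]
    constructor
    · intro h k hk
      simpa [cat, hk] using h ⟨k, hk⟩
    · intro h i
      simpa [cat] using h i i.2
  rw [h, MeasureTheory.measureReal_def, bernoulliMeasure, MeasureTheory.Measure.infinitePi_pi]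
  · simp
  · intros; exact MeasurableSet.singleton _

/-- The measure of the fixed point set. -/
def fixRatio (g : SInf) : ℝ := bernoulliMeasure.real (Fix (g : Perm X))

theorem fixRatio_toSInf (n : ℕ) (s : Perm (Xn n)) :
    fixRatio (toSInf n s) = (Finset.univ.filter fun x => s x = x).card / 2 ^ n := by
  have h : Fix (toSInf n s : Perm X) =
      ⋃ x ∈ Finset.univ.filter fun x => s x = x, {w : X | ∀ i : Fin n, w i = x i} := by
    ext w
    obtain ⟨⟨x, a⟩, rfl⟩ := (catEquiv n).surjective w
    have h1 : ∀ z : Xn n, (∀ i : Fin n, cat x a i = z i) ↔ x = z := fun z => by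
      simp [cat, funext_iff]
    have h2 : cat (s x) a = cat x a ↔ s x = x := by
      refine ⟨fun h => ?_, fun h => by rw [h]⟩
      exact (Prod.ext_iff.1 ((catEquiv n).injective (a₁ := (s x, a)) (a₂ := (x, a)) h)).1
    change act n s (cat x a) = cat x a ↔ _
    rw [act_cat, h2]
    simp only [Set.mem_iUnion, Finset.mem_filter, Finset.mem_univ, true_and]
    constructor
    · exact fun h => ⟨x, h, (h1 x).2 rfl⟩
    · rintro ⟨z, hz, hz'⟩
      rwa [(h1 z).1 hz']
  have hmeas : ∀ x : Xn n, MeasurableSet {w : X | ∀ i : Fin n, w i = x i} := fun x => by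
    rw [Set.ofPred_forall]
    exact MeasurableSet.iInter fun i => (measurable_pi_apply _) (MeasurableSet.singleton _)
  have : MeasureTheory.IsProbabilityMeasure bernoulliMeasure := by
    unfold bernoulliMeasure; infer_instance
  rw [fixRatio, h, MeasureTheory.measureReal_biUnion_finset]
  · simp [measureReal_cylinder, div_eq_mul_inv]
  · intro x _ y _ hxy
    refine Set.disjoint_left.2 fun w hx hy => hxy (funext fun i => (hx i).symm.trans (hy i))
  · exact fun x _ => hmeas x

theorem card_fixed_permCongr {α β : Type*} [Fintype α] [Fintype β] [DecidableEq α] [DecidableEq β]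
    (e : α ≃ β) (s : Perm α) :
    (Finset.univ.filter fun x => e.permCongr s x = x).card =
      (Finset.univ.filter fun x => s x = x).card := by
  rw [← Finset.card_map e.toEmbedding]
  congr 1
  ext x
  rw [Finset.mem_filter, Finset.mem_map_equiv, Finset.mem_filter, Equiv.permCongr_apply,
    Equiv.eq_symm_apply]
  simp only [Finset.mem_univ, true_and]

theorem fixRatio_prodAct (n : ℕ) {j : ℕ} {Y : Type*} [Fintype Y] [DecidableEq Y] (e : Y ≃ Xn j)
    (s : Perm (Xn n × Y)) :
    fixRatio (prodAct n e s) =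
      (Finset.univ.filter fun p => s p = p).card / (2 ^ n * Fintype.card Y) := by
  have hY : Fintype.card Y = 2 ^ j := by simp [Fintype.card_congr e]
  have h := fixRatio_toSInf (n + j)
    ((((Equiv.refl _).prodCongr e).trans (Fin.appendEquiv n j)).permCongr s)
  rw [hY]
  refine h.trans ?_
  rw [pow_add]
  push_cast
  rw [card_fixed_permCongr]

/-- The nontrivial cycles of an involution are transpositions, and their number is half the number
of moved points. -/
theorem isConj_of_involutive {Ω : Type*} [Fintype Ω] [DecidableEq Ω] {σ τ : Perm Ω}
    (hσ : σ * σ = 1) (hτ : τ * τ = 1)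
    (h : (Finset.univ.filter fun x => σ x = x).card = (Finset.univ.filter fun x => τ x = x).card) :
    IsConj σ τ := by
  have hs : ∀ ρ : Perm Ω, (Finset.univ.filter fun x => ρ x = x).card + ρ.cycleType.sum =
      Fintype.card Ω := fun ρ => by
    rw [Perm.sum_cycleType, ← Finset.card_univ,
      ← Finset.card_filter_add_card_filter_not (s := Finset.univ) (fun x => ρ x = x)]
    congr 2
  rw [Perm.isConj_iff_cycleType_eq]
  have : Fact (Nat.Prime 2) := ⟨Nat.prime_two⟩
  have h1 := Perm.cycleType_of_pow_prime_eq_one (p := 2) (by rwa [sq]) (σ := σ)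
  have h2 := Perm.cycleType_of_pow_prime_eq_one (p := 2) (by rwa [sq]) (σ := τ)
  have h3 := congrArg Multiset.sum h1
  have h4 := congrArg Multiset.sum h2
  rw [Multiset.sum_replicate, smul_eq_mul] at h3 h4
  have h5 := hs σ
  have h6 := hs τ
  rw [h1, h2]
  congr 1
  omega

end CantorPerm

/-! ### Involutions over a permutation, and dependence on the fixed-point ratio alone -/

namespace CantorPerm

open Equiv

/-- The permutation `τ` of `W × Y` is an involution whose fixed points are exactly the points lying
over the fixed points of `s`. -/
def IsInvolutionOver {W Y : Type*} (s : Perm W) (τ : Perm (W × Y)) : Prop :=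
  τ * τ = 1 ∧ ∀ p, τ p = p ↔ s p.1 = p.1

/-- The permutation `s` on one sheet and its inverse on the other. -/
def sheetPerm {W : Type*} (s : Perm W) (ε : Bool) : Perm W := bif ε then s⁻¹ else s

theorem sheetPerm_not {W : Type*} (s : Perm W) (ε : Bool) :
    sheetPerm s (!ε) = (sheetPerm s ε)⁻¹ := by
  cases ε <;> simp [sheetPerm]

theorem sheetPerm_apply_eq_iff {W : Type*} (s : Perm W) (ε : Bool) (x : W) :
    sheetPerm s ε x = x ↔ s x = x := by
  cases ε
  · rfl
  · exact Perm.inv_eq_iff_eq.trans eq_comm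

theorem apply_inv_apply {W : Type*} (s : Perm W) (x : W) : s (s⁻¹ x) = x :=
  s.apply_symm_apply x

section Skew

variable {W F : Type*} [Field F] (s : Perm W) (u : W → F)

/-- The skew product over `sheetPerm s` with the coboundary of `x ↦ u x * b`. -/
def skew (b : F) : Perm (W × (Bool × F)) where
  toFun p := (sheetPerm s p.2.1 p.1, p.2.1, p.2.2 + (u p.1 - u (sheetPerm s p.2.1 p.1)) * b)
  invFun p := ((sheetPerm s p.2.1)⁻¹ p.1, p.2.1,
    p.2.2 + (u p.1 - u ((sheetPerm s p.2.1)⁻¹ p.1)) * b)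
  left_inv p := by
    ext <;> simp
    ring
  right_inv p := by
    ext <;> simp
    ring

theorem skew_apply (b : F) (x : W) (ε : Bool) (y : F) :
    skew s u b (x, ε, y) = (sheetPerm s ε x, ε, y + (u x - u (sheetPerm s ε x)) * b) := rfl

theorem skew_inv_apply (b : F) (x : W) (ε : Bool) (y : F) :
    (skew s u b)⁻¹ (x, ε, y) =
      ((sheetPerm s ε)⁻¹ x, ε, y + (u x - u ((sheetPerm s ε)⁻¹ x)) * b) := rfl

/-- Translating the fibre over `x` by `u x * b` removes the coboundary; on the sheet carrying `s⁻¹`,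
a permutation `k` conjugating `s⁻¹` to `s` is applied as well. -/
theorem isConj_skew [Fintype W] [DecidableEq W] (b : F) :
    IsConj (skew s u b) (s.prodCongr (Equiv.refl (Bool × F))) := by
  have hs : IsConj s⁻¹ s := by rw [Perm.isConj_iff_cycleType_eq, Perm.cycleType_inv]
  obtain ⟨k, hk⟩ := isConj_iff.1 hs
  have hk' : ∀ x, k (s⁻¹ x) = s (k x) := fun x => by
    conv_rhs => rw [← hk]
    simp
  let κ : Perm (W × (Bool × F)) :=
    { toFun := fun p => ((bif p.2.1 then k else 1 : Perm W) p.1, p.2.1, p.2.2 + u p.1 * b)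
      invFun := fun p => ((bif p.2.1 then k else 1 : Perm W)⁻¹ p.1, p.2.1,
        p.2.2 - u ((bif p.2.1 then k else 1 : Perm W)⁻¹ p.1) * b)
      left_inv := fun p => by ext <;> simp
      right_inv := fun p => by ext <;> simp }
  have hκ : κ * skew s u b = s.prodCongr (Equiv.refl (Bool × F)) * κ := by
    ext1 ⟨x, ε, y⟩
    change ((bif ε then k else 1 : Perm W) (sheetPerm s ε x), ε,
      y + (u x - u (sheetPerm s ε x)) * b + u (sheetPerm s ε x) * b) =
      (s ((bif ε then k else 1 : Perm W) x), ε, y + u x * b)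
    refine Prod.ext ?_ (Prod.ext rfl ?_)
    · cases ε
      · rfl
      · exact hk' x
    · change _ + _ = _
      ring
  exact isConj_iff.2 ⟨κ, by rw [hκ]; simp⟩

variable [CharP F 2]

/-- The base motions cancel and leave the fibre translation by `(u (s^{∓1} x) - u x) * (b - c)`. It
is an involution in characteristic two, and it is nonzero off the fixed points because `u` is
injective and `F` has no zero divisors. -/
theorem isInvolutionOver_skew_mul (hu : Function.Injective u) {b c : F} (hbc : b ≠ c) :
    IsInvolutionOver s (skew s u b * (skew s u c)⁻¹) := by
  have hB : ∀ x ε y, (skew s u b * (skew s u c)⁻¹) (x, ε, y) =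
      (x, ε, y + (u ((sheetPerm s ε)⁻¹ x) - u x) * (b - c)) := fun x ε y => by
    rw [Perm.mul_apply, skew_inv_apply, skew_apply]
    simp only [apply_inv_apply, Prod.mk.injEq, true_and]
    ring
  constructor
  · ext1 ⟨x, ε, y⟩
    rw [Perm.mul_apply, hB, hB]
    refine Prod.ext rfl (Prod.ext rfl ?_)
    change y + _ + _ = y
    linear_combination ((u ((sheetPerm s ε)⁻¹ x) - u x) * (b - c)) * (CharTwo.two_eq_zero (R := F))
  · rintro ⟨x, ε, y⟩
    rw [hB, ← sheetPerm_apply_eq_iff s ε]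
    simp only [Prod.mk.injEq, true_and, add_eq_left, mul_eq_zero, sub_eq_zero, hu.eq_iff, hbc,
      or_false]
    rw [Perm.inv_eq_iff_eq, eq_comm]

variable [DecidableEq W]

/-- The involution exchanging the two sheets and translating by `c` off the fixed points of `s`. -/
def exchange (c : F) : Perm (W × (Bool × F)) :=
  Function.Involutive.toPerm
    (fun p => if s p.1 = p.1 then p else (p.1, !p.2.1, p.2.2 + c)) fun p => by
    by_cases h : s p.1 = p.1
    · simp [h]
    · simp [h, add_assoc, CharTwo.add_self_eq_zero]

theorem exchange_inv (c : F) : (exchange s c)⁻¹ = exchange s c := rfl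

theorem exchange_apply_of_eq (c : F) {p : W × (Bool × F)} (h : s p.1 = p.1) :
    exchange s c p = p := by
  change (if _ then _ else _) = _
  simp [h]

theorem exchange_apply_of_ne (c : F) {x : W} {ε : Bool} {y : F} (h : s x ≠ x) :
    exchange s c (x, ε, y) = (x, !ε, y + c) := by
  change (if _ then _ else _) = _
  simp [h]

theorem isInvolutionOver_exchange (c : F) : IsInvolutionOver s (exchange s c) := by
  refine ⟨inv_eq_iff_mul_eq_one.1 (exchange_inv s c), ?_⟩
  rintro ⟨x, ε, y⟩
  refine ⟨fun h => ?_, fun h => exchange_apply_of_eq s c h⟩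
  by_contra hx
  rw [exchange_apply_of_ne s c hx] at h
  simp at h

theorem isInvolutionOver_exchange_mul {c d : F} (hcd : c ≠ d) :
    IsInvolutionOver s (exchange s c * (exchange s d)⁻¹) := by
  have hA : ∀ p : W × (Bool × F), s p.1 = p.1 → (exchange s c * (exchange s d)⁻¹) p = p :=
    fun p hp => by
      rw [exchange_inv, Perm.mul_apply, exchange_apply_of_eq s d hp, exchange_apply_of_eq s c hp]
  have hB : ∀ x ε y, s x ≠ x →
      (exchange s c * (exchange s d)⁻¹) (x, ε, y) = (x, ε, y + d + c) := fun x ε y hx => by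
    rw [exchange_inv, Perm.mul_apply, exchange_apply_of_ne s d hx, exchange_apply_of_ne s c hx,
      Bool.not_not]
  constructor
  · ext1 ⟨x, ε, y⟩
    rw [Perm.mul_apply]
    by_cases hx : s x = x
    · rw [hA (x, ε, y) hx, hA (x, ε, y) hx]; rfl
    · rw [hB _ _ _ hx, hB _ _ _ hx]
      refine Prod.ext rfl (Prod.ext rfl ?_)
      change y + d + c + d + c = y
      linear_combination (c + d) * (CharTwo.two_eq_zero (R := F))
  · rintro ⟨x, ε, y⟩
    refine ⟨fun h => ?_, hA _⟩
    by_contra hx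
    rw [hB _ _ _ hx] at h
    simp only [Prod.mk.injEq, true_and, add_assoc, add_eq_left, CharTwo.add_eq_zero] at h
    exact hcd h.symm

/-- Off the fixed points the product switches sheets, so nothing is fixed there. Its second
application uses the inverse base motion, so the base motions and coboundaries cancel and the
translations add to `2 * c = 0`. This is why the two sheets carry inverse permutations. -/
theorem isInvolutionOver_skew_mul_exchange (b c : F) :
    IsInvolutionOver s (skew s u b * (exchange s c)⁻¹) := by
  have hA : ∀ p : W × (Bool × F), s p.1 = p.1 → (skew s u b * (exchange s c)⁻¹) p = p := by
    rintro ⟨x, ε, y⟩ hp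
    rw [exchange_inv, Perm.mul_apply, exchange_apply_of_eq s c hp, skew_apply,
      (sheetPerm_apply_eq_iff s ε x).2 hp]
    simp
  have hB : ∀ x ε y, s x ≠ x → (skew s u b * (exchange s c)⁻¹) (x, ε, y) =
      ((sheetPerm s ε)⁻¹ x, !ε, y + c + (u x - u ((sheetPerm s ε)⁻¹ x)) * b) :=
    fun x ε y hx => by
      rw [exchange_inv, Perm.mul_apply, exchange_apply_of_ne s c hx, skew_apply, sheetPerm_not]
  constructor
  · ext1 ⟨x, ε, y⟩
    rw [Perm.mul_apply]
    by_cases hx : s x = x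
    · rw [hA (x, ε, y) hx, hA (x, ε, y) hx]; rfl
    · have hx' : s ((sheetPerm s ε)⁻¹ x) ≠ (sheetPerm s ε)⁻¹ x := by
        rw [Ne, ← sheetPerm_apply_eq_iff s ε, apply_inv_apply, eq_comm, Perm.inv_eq_iff_eq,
          eq_comm, sheetPerm_apply_eq_iff]
        exact hx
      rw [hB _ _ _ hx, hB _ _ _ hx', sheetPerm_not, inv_inv, apply_inv_apply, Bool.not_not]
      refine Prod.ext rfl (Prod.ext rfl ?_)
      change y + c + _ + c + _ = y
      linear_combination c * (CharTwo.two_eq_zero (R := F))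
  · rintro ⟨x, ε, y⟩
    refine ⟨fun h => ?_, hA _⟩
    by_contra hx
    rw [hB _ _ _ hx] at h
    simp at h

end Skew

theorem IsInvolutionOver.isConj {W Y : Type*} [Fintype W] [DecidableEq W] [Fintype Y]
    [DecidableEq Y] {s s' : Perm W} {τ τ' : Perm (W × Y)} (h : IsInvolutionOver s τ)
    (h' : IsInvolutionOver s' τ')
    (hs : (Finset.univ.filter fun x => s x = x).card =
      (Finset.univ.filter fun x => s' x = x).card) : IsConj τ τ' := by
  refine isConj_of_involutive h.1 h'.1 ?_
  have key : ∀ s : Perm W, (Finset.univ.filter fun p : W × Y => s p.1 = p.1).card =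
      (Finset.univ.filter fun x => s x = x).card * Fintype.card Y := fun s => by
    rw [← Finset.card_univ, ← Finset.card_product]
    congr 1
    ext p
    simp
  simp only [h.2, h'.2, key, hs]

/-- The exchanges and the skew products, both indexed by `F`, are the two families in the
Cauchy–Schwarz estimate. The right side is `2 * (1 - c.re)` with `-1 ≤ c.re`. -/
theorem card_mul_normSq_exchange_sub_le {χ : SInf → ℂ} (hχ : IsCharacter χ) {n j : ℕ} {F : Type*}
    [Field F] [CharP F 2] [Fintype F] [DecidableEq F] (e : Bool × F ≃ Xn j) (u : Xn n → F)
    (hu : Function.Injective u) (s : Perm (Xn n)) :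
    Fintype.card F * Complex.normSq (χ (prodAct n e (exchange s 0)) - χ (toSInf n s)) ≤ 4 := by
  have hψ := hχ.comp (prodAct n e)
  have hval : ∀ τ, IsInvolutionOver s τ → χ (prodAct n e τ) = χ (prodAct n e (exchange s 0)) :=
    fun τ hτ => hψ.map_conj (hτ.isConj (isInvolutionOver_exchange s 0) rfl)
  have h := hψ.card_mul_normSq_le (exchange s) (skew s u) (c := χ (prodAct n e (exchange s 0)))
    (d := χ (toSInf n s)) (by rw [← hψ.map_inv, exchange_inv])
    (fun a b hab => hval _ (isInvolutionOver_exchange_mul s hab))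
    (fun a b hab => hval _ (isInvolutionOver_skew_mul s u hu hab))
    (fun a b => hval _ (isInvolutionOver_skew_mul_exchange s u a b))
    (fun a => hval _ (isInvolutionOver_exchange s a))
    (fun a => by rw [← prodAct_prodCongr n e]; exact hψ.map_conj (isConj_skew s u a))
  have h1 := hψ.neg_one_le_re (exchange s 0)
  linarith

/-- A character of `S(2^∞)` depends only on the measure of the fixed point set. -/
theorem apply_eq_of_fixRatio_eq {χ : SInf → ℂ} (hχ : IsCharacter χ) {g g' : SInf}
    (h : fixRatio g = fixRatio g') : χ g = χ g' := by
  obtain ⟨n, hn⟩ := exists_toSInf_eq_of_finite ![g, g']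
  obtain ⟨s, rfl : _ = g⟩ := hn 0
  obtain ⟨s', rfl : _ = g'⟩ := hn 1
  have hs : (Finset.univ.filter fun x => s x = x).card =
      (Finset.univ.filter fun x => s' x = x).card := by
    rw [fixRatio_toSInf, fixRatio_toSInf, div_left_inj' (by positivity)] at h
    exact_mod_cast h
  -- Both values are close to the common value `a` on involutions; `16 = 2 * (4 + 4)` comes from `(p
  -- + q)² ≤ 2 * (p² + q²)`.
  have key : ∀ m : ℕ, (m : ℝ) * ‖χ (toSInf n s) - χ (toSInf n s')‖ ^ 2 ≤ 16 := by
    intro m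
    -- Large enough that `2 ^ k ≥ m`, that `Xn n` embeds in `F`, and that `k ≠ 0`.
    let k := m + n + 1
    let F := GaloisField 2 k
    let _ : Fintype F := Fintype.ofFinite F
    have hF : Fintype.card F = 2 ^ k := by
      rw [← Nat.card_eq_fintype_card]; exact GaloisField.card 2 k (by omega)
    classical
    let e : Bool × F ≃ Xn (k + 1) := Fintype.equivOfCardEq (by simp [hF, pow_succ'])
    obtain ⟨u⟩ : Nonempty (Xn n ↪ F) := Function.Embedding.nonempty_of_card_le (by
      simp only [hF, Fintype.card_fun, Fintype.card_bool, Fintype.card_fin]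
      exact Nat.pow_le_pow_right (by norm_num) (by omega))
    have h1 := card_mul_normSq_exchange_sub_le hχ e u u.injective s
    have h2 := card_mul_normSq_exchange_sub_le hχ e u u.injective s'
    have h3 : χ (prodAct n e (exchange s 0)) = χ (prodAct n e (exchange s' 0)) :=
      (hχ.comp (prodAct n e)).map_conj
        ((isInvolutionOver_exchange s 0).isConj (isInvolutionOver_exchange s' 0) hs)
    rw [← h3] at h2
    rw [Complex.normSq_eq_norm_sq] at h1 h2
    set a := χ (prodAct n e (exchange s 0))
    have h4 : ‖χ (toSInf n s) - χ (toSInf n s')‖ ≤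
        ‖a - χ (toSInf n s)‖ + ‖a - χ (toSInf n s')‖ := by
      rw [norm_sub_rev a (χ (toSInf n s))]
      exact norm_sub_le_norm_sub_add_norm_sub _ _ _
    have h5 : (m : ℝ) ≤ Fintype.card F := by
      rw [hF]
      exact_mod_cast (show m ≤ k by omega).trans Nat.lt_two_pow_self.le
    have h6 : ‖χ (toSInf n s) - χ (toSInf n s')‖ ^ 2 ≤
        2 * (‖a - χ (toSInf n s)‖ ^ 2 + ‖a - χ (toSInf n s')‖ ^ 2) :=
      (pow_le_pow_left₀ (norm_nonneg _) h4 2).trans add_sq_le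
    calc (m : ℝ) * ‖χ (toSInf n s) - χ (toSInf n s')‖ ^ 2
        ≤ Fintype.card F * (2 * (‖a - χ (toSInf n s)‖ ^ 2 + ‖a - χ (toSInf n s')‖ ^ 2)) := by
          gcongr
      _ ≤ 16 := by linarith
  by_contra hne
  have hpos : 0 < ‖χ (toSInf n s) - χ (toSInf n s')‖ ^ 2 := by
    have := norm_pos_iff.2 (sub_ne_zero.2 hne)
    positivity
  obtain ⟨m, hm⟩ := exists_nat_gt (16 / ‖χ (toSInf n s) - χ (toSInf n s')‖ ^ 2)
  rw [div_lt_iff₀ hpos] at hm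
  exact absurd (key m) (not_le.2 hm)

end CantorPerm

/-! ### Fibre translations and nonnegative differences -/

namespace CantorPerm

open Equiv

theorem fixRatio_inv (g : SInf) : fixRatio g⁻¹ = fixRatio g := by
  unfold fixRatio Fix
  congr 1
  ext x
  exact Perm.inv_eq_iff_eq.trans eq_comm

/-- A character of `S(2^∞)` is a real function of the measure of the fixed point set. -/
theorem exists_apply_eq_fixRatio {χ : SInf → ℂ} (hχ : IsCharacter χ) :
    ∃ f : ℝ → ℝ, ∀ g, χ g = (f (fixRatio g) : ℂ) := by
  classical
  refine ⟨fun x => if h : ∃ g, fixRatio g = x then (χ h.choose).re else 0, fun g => ?_⟩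
  have h : ∃ g', fixRatio g' = fixRatio g := ⟨g, rfl⟩
  beta_reduce
  rw [dif_pos h, apply_eq_of_fixRatio_eq hχ h.choose_spec]
  -- The value is real: `g` and `g⁻¹` have the same ratio and conjugate character values.
  refine (Complex.conj_eq_iff_re.1 ?_).symm
  exact (hχ.map_inv g).symm.trans (apply_eq_of_fixRatio_eq hχ (fixRatio_inv g))

section Translate

variable {W Y : Type*} [AddCommGroup Y]

/-- The permutation of `W × Y` translating the fibre over `x` by `v x`. -/
def translate (v : W → Y) : Perm (W × Y) where
  toFun p := (p.1, p.2 + v p.1)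
  invFun p := (p.1, p.2 - v p.1)
  left_inv p := by simp
  right_inv p := by simp

theorem translate_mul_inv (v w : W → Y) :
    translate v * (translate w)⁻¹ = translate (v - w) := by
  ext1 p
  change (p.1, p.2 - w p.1 + v p.1) = (p.1, p.2 + (v p.1 - w p.1))
  refine Prod.ext rfl ?_
  change p.2 - w p.1 + v p.1 = p.2 + (v p.1 - w p.1)
  rw [sub_add_eq_add_sub, add_sub_assoc]

theorem fixRatio_translate [Fintype Y] [DecidableEq Y] {n j : ℕ} (e : Y ≃ Xn j) (v : Xn n → Y) :
    fixRatio (prodAct n e (translate v)) =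
      (Finset.univ.filter fun x => v x = 0).card / 2 ^ n := by
  have h : (Finset.univ.filter fun p : Xn n × Y => translate v p = p) =
      (Finset.univ.filter fun x => v x = 0) ×ˢ Finset.univ := by
    ext p
    simp [translate, Prod.ext_iff]
  rw [fixRatio_prodAct, h, Finset.card_product, Finset.card_univ]
  push_cast
  have : (Fintype.card Y : ℝ) ≠ 0 := by exact_mod_cast Fintype.card_ne_zero
  field_simp

end Translate

theorem sum_powerset_symmDiff {α M : Type*} [DecidableEq α] [AddCommMonoid M] (J S : Finset α)
    (hS : S ⊆ J) (F : Finset α → M) :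
    ∑ T ∈ J.powerset, F (symmDiff S T) = ∑ T ∈ J.powerset, F T := by
  have hmem : ∀ T ∈ J.powerset, symmDiff S T ∈ J.powerset := fun T hT => by
    rw [Finset.mem_powerset] at hT ⊢
    exact symmDiff_le_sup.trans (sup_le hS hT)
  exact Finset.sum_nbij' (fun T => symmDiff S T) (fun T => symmDiff S T) hmem hmem
    (fun T _ => symmDiff_symmDiff_cancel_left S T) (fun T _ => symmDiff_symmDiff_cancel_left S T)
    fun T _ => rfl

theorem neg_one_pow_card_symmDiff {α : Type*} [DecidableEq α] (S T : Finset α) :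
    (-1 : ℝ) ^ (symmDiff S T).card = (-1) ^ S.card * (-1) ^ T.card := by
  have h : (symmDiff S T).card + 2 * (S ∩ T).card = S.card + T.card := by
    have h1 : (symmDiff S T).card = (S \ T).card + (T \ S).card :=
      Finset.card_union_of_disjoint disjoint_sdiff_sdiff
    have h2 := Finset.card_sdiff_add_card_inter S T
    have h3 := Finset.card_sdiff_add_card_inter T S
    rw [Finset.inter_comm T S] at h3
    omega
  rw [← pow_add, ← h, pow_add, pow_mul]
  simp

/-- Positivity of a character on the translations of the fibres, tested against signs on the
fibres over `J`. -/
theorem alternating_sum_add_nonneg {χ : SInf → ℂ} (hχ : IsCharacter χ) {f : ℝ → ℝ}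
    (hf : ∀ g, χ g = (f (fixRatio g) : ℂ)) {n : ℕ} (J : Finset (Xn n)) (K : ℕ) :
    0 ≤ (∑ T ∈ J.powerset, (-1) ^ T.card * f (((J \ T).card + Jᶜ.card : ℕ) / 2 ^ n)) +
      ((2 : ℝ) ^ (K + 1) - 1) *
        ∑ T ∈ J.powerset, (-1) ^ T.card * f ((J \ T).card / 2 ^ n) := by
  set D' := ∑ T ∈ J.powerset, (-1) ^ T.card * f (((J \ T).card + Jᶜ.card : ℕ) / 2 ^ n) with hD'
  set D := ∑ T ∈ J.powerset, (-1) ^ T.card * f ((J \ T).card / 2 ^ n) with hD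
  let Y := ZMod (2 ^ (K + 1))
  have : Fact (1 < 2 ^ (K + 1)) := ⟨Nat.one_lt_two_pow (by omega)⟩
  have hY : Fintype.card Y = 2 ^ (K + 1) := ZMod.card _
  let e : Y ≃ Xn (K + 1) := Fintype.equivOfCardEq (by simp [hY])
  -- The difference of the translations for `(S, r)` and `(T, r')` vanishes on `J` outside `symmDiff
  -- S T`, and on all or none of `Jᶜ` according to whether `r = r'`.
  let v : Finset (Xn n) × Y → Xn n → Y :=
    fun p x => if x ∈ J then (if x ∈ p.1 then 1 else 0) else p.2
  have hχ' : ∀ p q : Finset (Xn n) × Y,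
      χ (prodAct n e (translate (v p)) * (prodAct n e (translate (v q)))⁻¹) =
        (f (((J \ symmDiff p.1 q.1).card + if p.2 = q.2 then Jᶜ.card else 0 : ℕ) / 2 ^ n) : ℂ) := by
    intro p q
    rw [← map_inv, ← map_mul, translate_mul_inv, hf, fixRatio_translate]
    congr 4
    have hset : (Finset.univ.filter fun x => (v p - v q) x = 0) =
        (J \ symmDiff p.1 q.1) ∪ (if p.2 = q.2 then Jᶜ else ∅) := by
      ext x
      by_cases hx : x ∈ J <;> by_cases h1 : x ∈ p.1 <;> by_cases h2 : x ∈ q.1 <;>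
        by_cases h3 : p.2 = q.2 <;> simp [v, hx, h1, h2, h3, Finset.mem_symmDiff, sub_eq_zero]
    rw [hset, Finset.card_union_of_disjoint]
    · split_ifs <;> simp
    · split_ifs
      · exact Finset.disjoint_left.2 fun x hx hx' =>
          (Finset.mem_compl.1 hx') (Finset.mem_sdiff.1 hx).1
      · simp
  have key := hχ.sum_nonneg (ι := J.powerset × Y)
    (fun p => prodAct n e (translate (v (p.1.1, p.2)))) (fun p => (((-1) ^ p.1.1.card : ℝ) : ℂ))
  have hsum : ∑ p : J.powerset × Y, ∑ q : J.powerset × Y,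
      (-1) ^ p.1.1.card *
        f (((J \ symmDiff p.1.1 q.1.1).card +
          if p.2 = q.2 then Jᶜ.card else 0 : ℕ) / 2 ^ n) * (-1) ^ q.1.1.card =
      2 ^ J.card * 2 ^ (K + 1) * (D' + ((2 : ℝ) ^ (K + 1) - 1) * D) := by
    -- For each `p`, reindexing by the symmetric difference makes every fibre label `r` contribute
    -- `D`, except `r = p.2`, which contributes `D'`.
    have h1 : ∀ p : J.powerset × Y, ∑ q : J.powerset × Y,
      (-1) ^ p.1.1.card *
        f (((J \ symmDiff p.1.1 q.1.1).card +
          if p.2 = q.2 then Jᶜ.card else 0 : ℕ) / 2 ^ n) * (-1) ^ q.1.1.card =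
        D' + ((2 : ℝ) ^ (K + 1) - 1) * D := by
      intro p
      have h2 : ∀ r : Y, ∑ T : J.powerset, (-1) ^ p.1.1.card *
          f (((J \ symmDiff p.1.1 T.1).card +
            if p.2 = r then Jᶜ.card else 0 : ℕ) / 2 ^ n) * (-1) ^ T.1.card =
          D + if p.2 = r then D' - D else 0 := by
        intro r
        have h3 := sum_powerset_symmDiff J p.1.1 (Finset.mem_powerset.1 p.1.2) fun T =>
          (-1) ^ T.card * f (((J \ T).card + if p.2 = r then Jᶜ.card else 0 : ℕ) / 2 ^ n)
        rw [Finset.sum_coe_sort J.powerset fun T => (-1) ^ p.1.1.card *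
          f (((J \ symmDiff p.1.1 T).card +
            if p.2 = r then Jᶜ.card else 0 : ℕ) / 2 ^ n) * (-1) ^ T.card]
        refine Eq.trans (Finset.sum_congr rfl fun T _ => ?_) (h3.trans ?_)
        · rw [neg_one_pow_card_symmDiff]; ring
        · split_ifs
          · simp [hD']
          · simp [hD]
      rw [Fintype.sum_prod_type_right]
      simp only [h2, Finset.sum_add_distrib, Finset.sum_const, Finset.sum_ite_eq, Finset.mem_univ,
        if_true, Finset.card_univ, hY, nsmul_eq_mul]
      push_cast
      ring
    simp only [h1, Finset.sum_const, Finset.card_univ, Fintype.card_prod, hY, Fintype.card_coe,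
      Finset.card_powerset, nsmul_eq_mul]
    push_cast
    ring
  have key2 : (0 : ℂ) ≤ ((2 ^ J.card * 2 ^ (K + 1) * (D' + ((2 : ℝ) ^ (K + 1) - 1) * D) : ℝ) : ℂ) := by
    rw [← hsum]
    refine key.trans_eq ?_
    simp only [hχ']
    push_cast
    simp
  exact nonneg_of_mul_nonneg_right (by exact_mod_cast key2) (by positivity)

/-- As `K` grows, the contribution of `Jᶜ` stays fixed while this sum is multiplied by `2 ^ (K + 1)
- 1`, so it cannot be negative. -/
theorem alternating_sum_nonneg {χ : SInf → ℂ} (hχ : IsCharacter χ) {f : ℝ → ℝ}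
    (hf : ∀ g, χ g = (f (fixRatio g) : ℂ)) {n : ℕ} (J : Finset (Xn n)) :
    0 ≤ ∑ T ∈ J.powerset, (-1) ^ T.card * f ((J \ T).card / 2 ^ n) := by
  have h := alternating_sum_add_nonneg hχ hf J
  by_contra! hD
  set D' := ∑ T ∈ J.powerset, (-1) ^ T.card * f (((J \ T).card + Jᶜ.card : ℕ) / 2 ^ n)
  set D := ∑ T ∈ J.powerset, (-1) ^ T.card * f ((J \ T).card / 2 ^ n)
  obtain ⟨K, hK⟩ := exists_nat_gt (D' / -D)
  rw [div_lt_iff₀ (by linarith)] at hK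
  have hK2 : (K : ℝ) ≤ 2 ^ (K + 1) - 1 := by
    have h1 : K + 1 ≤ 2 ^ (K + 1) := Nat.lt_two_pow_self.le
    have h2 : ((K + 1 : ℕ) : ℝ) ≤ 2 ^ (K + 1) := by exact_mod_cast h1
    push_cast at h2
    linarith
  nlinarith [h K]

/-- The profile of a character has nonnegative iterated differences at `0`. -/
theorem fwdDiff_iter_nonneg {χ : SInf → ℂ} (hχ : IsCharacter χ) {f : ℝ → ℝ}
    (hf : ∀ g, χ g = (f (fixRatio g) : ℂ)) {n j : ℕ} (hj : j ≤ 2 ^ n) :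
    0 ≤ (fwdDiff 1)^[j] (fun k : ℕ => f (k / 2 ^ n)) 0 := by
  obtain ⟨J, -, hJ⟩ := Finset.exists_subset_card_eq
    (s := (Finset.univ : Finset (Xn n))) (n := j) (by simpa using hj)
  have h := alternating_sum_nonneg hχ hf J
  have h1 : ∑ T ∈ J.powerset, (-1) ^ T.card * f ((J \ T).card / 2 ^ n) =
      ∑ T ∈ J.powerset, (fun m : ℕ => (-1) ^ m * f ((j - m : ℕ) / 2 ^ n)) T.card :=
    Finset.sum_congr rfl fun T hT => by
      simp only [Finset.card_sdiff_of_subset (Finset.mem_powerset.1 hT), hJ]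
  rw [h1, Finset.sum_powerset_apply_card (fun m : ℕ => (-1) ^ m * f ((j - m : ℕ) / 2 ^ n)), hJ] at h
  rw [fwdDiff_iter_eq_sum_shift, ← Finset.sum_range_reflect]
  refine h.trans_eq (Finset.sum_congr rfl fun m hm => ?_)
  have hm' : m ≤ j := by simpa [Nat.lt_succ_iff] using hm
  have h2 : j + 1 - 1 - m = j - m := by omega
  have h3 : j - (j - m) = m := by omega
  simp only [h2, h3, Nat.choose_symm hm', nsmul_eq_mul, zsmul_eq_mul, zero_add, smul_eq_mul, mul_one]
  push_cast
  ring

end CantorPerm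

/-! ### Newton expansion and its limit -/

namespace CantorPerm

open Equiv Filter Topology

theorem cast_choose_succ (n k : ℕ) :
    (n.choose (k + 1) : ℝ) * (k + 1) = n.choose k * ((n : ℝ) - k) := by
  rcases le_or_gt k n with h | h
  · have := Nat.choose_succ_right_eq n k
    rw [← Nat.cast_sub h]
    exact_mod_cast this
  · simp [Nat.choose_eq_zero_of_lt h, Nat.choose_eq_zero_of_lt (h.trans (Nat.lt_succ_self k))]

theorem choose_div_choose_succ {k N j : ℕ} (hj : j < N) :
    (k.choose (j + 1) : ℝ) / N.choose (j + 1) =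
      k.choose j / N.choose j * (((k : ℝ) - j) / ((N : ℝ) - j)) := by
  have h1 := cast_choose_succ k j
  have h2 := cast_choose_succ N j
  have h3 : (N.choose j : ℝ) ≠ 0 := by exact_mod_cast (Nat.choose_pos hj.le).ne'
  have h4 : (N.choose (j + 1) : ℝ) ≠ 0 := by exact_mod_cast (Nat.choose_pos hj).ne'
  have h5 : (N : ℝ) - j ≠ 0 := sub_ne_zero.2 (by exact_mod_cast hj.ne')
  have h6 : (j : ℝ) + 1 ≠ 0 := by positivity
  rw [div_mul_div_comm, ← h1, ← h2, mul_div_mul_right _ _ h6]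

/-- The ratio is a product of factors `(k - i) / (N - i) ≤ k / N`. This gives the geometric majorant
for dominated convergence. -/
theorem choose_div_choose_le {k N : ℕ} (hk : k ≤ N) (hN : 0 < N) (j : ℕ) :
    (k.choose j : ℝ) / N.choose j ≤ ((k : ℝ) / N) ^ j := by
  induction j with
  | zero => simp
  | succ j ih =>
    rcases lt_or_ge j N with hj | hj
    · rcases lt_or_ge k j with hkj | hkj
      · rw [Nat.choose_eq_zero_of_lt (hkj.trans (Nat.lt_succ_self j))]
        simp only [Nat.cast_zero, zero_div]
        positivity
      · rw [choose_div_choose_succ hj, pow_succ]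
        have h1 : (0 : ℝ) < N := by exact_mod_cast hN
        have h2 : (0 : ℝ) < (N : ℝ) - j := sub_pos.2 (by exact_mod_cast hj)
        have h3 : (k : ℝ) ≤ N := by exact_mod_cast hk
        have h4 : (j : ℝ) ≤ k := by exact_mod_cast hkj
        refine mul_le_mul ih ?_ (div_nonneg (by linarith) h2.le) (by positivity)
        rw [div_le_div_iff₀ h2 h1]
        nlinarith [mul_nonneg (Nat.cast_nonneg (α := ℝ) j) (sub_nonneg.2 h3)]
    -- Here the denominator is zero and the quotient is `0` by convention.
    · rw [Nat.choose_eq_zero_of_lt (show N < j + 1 by omega)]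
      simp only [Nat.cast_zero, div_zero]
      positivity

theorem tendsto_choose_div_choose {x : ℝ} {k : ℕ → ℕ} (hk : ∀ᶠ n in atTop, (k n : ℝ) = x * 2 ^ n)
    (j : ℕ) :
    Tendsto (fun n => ((k n).choose j : ℝ) / (2 ^ n).choose j) atTop (𝓝 (x ^ j)) := by
  have hpow : Tendsto (fun n : ℕ => (2 : ℝ) ^ n) atTop atTop :=
    tendsto_pow_atTop_atTop_of_one_lt (by norm_num)
  induction j with
  | zero => simp
  | succ j ih =>
    have h0 : Tendsto (fun n : ℕ => (j : ℝ) / 2 ^ n) atTop (𝓝 0) := hpow.const_div_atTop _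
    have h1 : Tendsto (fun n : ℕ => (x - j / 2 ^ n) / (1 - j / 2 ^ n)) atTop (𝓝 x) := by
      have h := (h0.const_sub x).div (h0.const_sub 1) (by simp)
      rwa [sub_zero, sub_zero, div_one] at h
    rw [pow_succ]
    refine (ih.mul h1).congr' ?_
    filter_upwards [hk, eventually_gt_atTop j] with n hn hj
    have hj' : j < 2 ^ n := hj.trans Nat.lt_two_pow_self
    rw [choose_div_choose_succ hj', hn]
    push_cast
    congr 1
    have : (2 : ℝ) ^ n ≠ 0 := by positivity
    rw [← mul_div_mul_right _ _ this]
    congr 1 <;> field_simp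

theorem fixRatio_one : fixRatio 1 = 1 := by
  have h := fixRatio_toSInf 0 1
  rw [map_one] at h
  simpa using h

theorem fixRatio_nonneg (g : SInf) : 0 ≤ fixRatio g := MeasureTheory.measureReal_nonneg

theorem exists_fixRatio_mul_eq (g : SInf) :
    ∃ k : ℕ → ℕ, ∀ᶠ n in atTop, (k n : ℝ) = fixRatio g * 2 ^ n ∧ k n ≤ 2 ^ n := by
  obtain ⟨m, hm⟩ := exists_toSInf_eq g
  have h : ∀ n, ∃ k : ℕ, m ≤ n → (k : ℝ) = fixRatio g * 2 ^ n ∧ k ≤ 2 ^ n := fun n => by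
    by_cases hn : m ≤ n
    · obtain ⟨s, rfl⟩ := hm n hn
      refine ⟨(Finset.univ.filter fun x => s x = x).card, fun _ => ⟨?_, ?_⟩⟩
      · rw [fixRatio_toSInf, div_mul_cancel₀ _ (by positivity)]
      · refine (Finset.card_le_univ _).trans_eq ?_
        simp
    · exact ⟨0, fun h => absurd h hn⟩
  choose k hk using h
  exact ⟨k, (eventually_ge_atTop m).mono hk⟩

/-- Newton's forward difference formula, normalised so that the weights do not depend on `k` and sum
to `φ N` when `k = N`. -/
theorem newton_choose (φ : ℕ → ℝ) (k N : ℕ) (hk : k ≤ N) :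
    HasSum (fun j => (N.choose j * (fwdDiff 1)^[j] φ 0) * ((k.choose j : ℝ) / N.choose j))
      (φ k) := by
  have h := shift_eq_sum_fwdDiff_iter 1 φ k 0
  simp only [smul_eq_mul, mul_one, zero_add, nsmul_eq_mul] at h
  rw [h]
  have h' : ∑ j ∈ Finset.range (k + 1), (k.choose j : ℝ) * (fwdDiff 1)^[j] φ 0 =
      ∑ j ∈ Finset.range (k + 1),
        (N.choose j * (fwdDiff 1)^[j] φ 0) * ((k.choose j : ℝ) / N.choose j) :=
    Finset.sum_congr rfl fun j hj => by
      have : (N.choose j : ℝ) ≠ 0 := by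
        exact_mod_cast (Nat.choose_pos ((Finset.mem_range_succ_iff.1 hj).trans hk)).ne'
      field_simp
  rw [h']
  refine hasSum_sum_of_ne_finset_zero fun j hj => ?_
  rw [Nat.choose_eq_zero_of_lt (by simpa [Nat.lt_succ_iff] using hj : k < j)]
  simp

/-- Every character of `S(2^∞)` is a power series with nonnegative coefficients in the measure of
the fixed point set. -/
theorem exists_hasSum_pow {χ : SInf → ℂ} (hχ : IsCharacter χ) :
    ∃ p : ℕ → ℝ, (∀ j, 0 ≤ p j) ∧ Summable p ∧ ∑' j, p j ≤ 1 ∧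
      ∀ g, fixRatio g < 1 → HasSum (fun j => ((p j * fixRatio g ^ j : ℝ) : ℂ)) (χ g) := by
  obtain ⟨f, hf⟩ := exists_apply_eq_fixRatio hχ
  have hf1 : f 1 = 1 := by
    have h := hf 1
    rw [hχ.map_one, fixRatio_one] at h
    exact_mod_cast h.symm
  let P : ℕ → ℕ → ℝ := fun n j =>
    (2 ^ n).choose j * (fwdDiff 1)^[j] (fun k : ℕ => f (k / 2 ^ n)) 0
  have hP0 : ∀ n j, 0 ≤ P n j := fun n j => by
    rcases le_or_gt j (2 ^ n) with hj | hj
    · exact mul_nonneg (Nat.cast_nonneg _) (fwdDiff_iter_nonneg hχ hf hj)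
    · simp [P, Nat.choose_eq_zero_of_lt hj]
  have hP1 : ∀ n, HasSum (P n) 1 := fun n => by
    have h := newton_choose (fun k : ℕ => f (k / 2 ^ n)) (2 ^ n) (2 ^ n) le_rfl
    have h2 : ((2 ^ n : ℕ) : ℝ) / 2 ^ n = 1 := by push_cast; exact div_self (by positivity)
    beta_reduce at h
    rw [h2, hf1] at h
    refine h.congr_fun fun j => ?_
    rcases le_or_gt j (2 ^ n) with hj | hj
    · rw [div_self (by exact_mod_cast (Nat.choose_pos hj).ne'), mul_one]
    · simp [P, Nat.choose_eq_zero_of_lt hj]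
  have hPle : ∀ n (t : Finset ℕ), ∑ j ∈ t, P n j ≤ 1 := fun n t =>
    sum_le_hasSum t (fun j _ => hP0 n j) (hP1 n)
  have hPle1 : ∀ n j, P n j ≤ 1 := fun n j => by simpa using hPle n {j}
  -- An ultrafilter gives limits of all weights at once. Mass may escape to infinity in `j`, so only
  -- `∑' j, p j ≤ 1` survives.
  let U : Ultrafilter ℕ := hyperfilter ℕ
  have hU : (U : Filter ℕ) ≤ atTop := by
    rw [← Nat.cofinite_eq_atTop]
    exact hyperfilter_le_cofinite
  have hlim : ∀ j, ∃ a, Tendsto (fun n => P n j) U (𝓝 a) := fun j => by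
    obtain ⟨a, -, ha⟩ := (isCompact_Icc (a := (0 : ℝ)) (b := 1)).ultrafilter_le_nhds
      (U.map fun n => P n j) (by
        rw [le_principal_iff]
        exact Filter.mem_map.2 (univ_mem' fun n => ⟨hP0 n j, hPle1 n j⟩))
    exact ⟨a, ha⟩
  choose p hp using hlim
  have hp0 : ∀ j, 0 ≤ p j := fun j => ge_of_tendsto' (hp j) fun n => hP0 n j
  have hple : ∀ t : Finset ℕ, ∑ j ∈ t, p j ≤ 1 := fun t =>
    le_of_tendsto' (tendsto_finsetSum t fun j _ => hp j) fun n => hPle n t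
  have hsum : Summable p := summable_of_sum_le hp0 hple
  refine ⟨p, hp0, hsum, hsum.tsum_le_of_sum_le hple, fun g hg => ?_⟩
  obtain ⟨k, hk⟩ := exists_fixRatio_mul_eq g
  have hx0 := fixRatio_nonneg g
  set x := fixRatio g with hx
  have hgeo : Summable fun j : ℕ => x ^ j := summable_geometric_of_lt_one hx0 hg
  -- The majorant is `x ^ j`, since the weights are at most `1`; its summability is where `x < 1` is
  -- needed.
  have hT := tendsto_tsum_of_dominated_convergence (𝓕 := (U : Filter ℕ))
    (f := fun n j => P n j * (((k n).choose j : ℝ) / (2 ^ n).choose j))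
    (g := fun j => p j * x ^ j) hgeo
    (fun j => (hp j).mul ((tendsto_choose_div_choose (hk.mono fun n h => h.1) j).mono_left hU))
    (by
      filter_upwards [hU hk] with n hn j
      rw [Real.norm_of_nonneg (mul_nonneg (hP0 n j) (by positivity))]
      have h1 := choose_div_choose_le hn.2 (by positivity) j
      have h2 : ((k n : ℝ) / (2 ^ n : ℕ)) = x := by
        rw [hn.1]; push_cast; field_simp
      rw [h2] at h1
      exact (mul_le_of_le_one_left (by positivity) (hPle1 n j)).trans h1)
  have hconst : Tendsto (fun n => ∑' j, P n j * (((k n).choose j : ℝ) / (2 ^ n).choose j))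
      (U : Filter ℕ) (𝓝 (f x)) := by
    refine tendsto_const_nhds.congr' ?_
    filter_upwards [hU hk] with n hn
    have h := (newton_choose (fun k : ℕ => f (k / 2 ^ n)) (k n) (2 ^ n) hn.2).tsum_eq
    have h2 : ((k n : ℝ) / 2 ^ n) = x := by rw [hn.1]; field_simp
    beta_reduce at h
    rw [h2] at h
    exact h.symm
  have hval := tendsto_nhds_unique hconst hT
  have hs : Summable fun j => p j * x ^ j :=
    hsum.of_nonneg_of_le (fun j => mul_nonneg (hp0 j) (by positivity))
      fun j => mul_le_of_le_one_right (hp0 j) (pow_le_one₀ hx0 hg.le)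
  rw [hf g, ← hx, hval]
  exact Complex.hasSum_ofReal.2 hs.hasSum

end CantorPerm

/-! ### Limits and countable mixtures of characters -/

open Filter Topology

namespace IsCharacter

variable {G : Type*} [Group G]

theorem of_tendsto {ψ : ℕ → G → ℂ} {χ : G → ℂ} (hψ : ∀ k, IsCharacter (ψ k))
    (h : ∀ g, Tendsto (fun k => ψ k g) atTop (𝓝 (χ g))) : IsCharacter χ := by
  refine of_sum_nonneg (fun g g' => ?_) (fun g => ?_) (fun n g a => ?_) ?_
  · exact tendsto_nhds_unique (h _) ((h (g' * g)).congr fun k => (hψ k).central g' g)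
  · exact tendsto_nhds_unique (h _) ((h g).star.congr fun k => ((hψ k).map_inv g).symm)
  · exact ge_of_tendsto' (tendsto_finsetSum _ fun i _ => tendsto_finsetSum _ fun j _ =>
      ((h _).const_mul _).mul_const _) fun k => (hψ k).sum_nonneg g a
  · exact tendsto_nhds_unique (h 1) (tendsto_const_nhds.congr fun k => (hψ k).map_one.symm)

theorem of_hasSum {ι : Type*} {ψ : ι → G → ℂ} {χ : G → ℂ} {p : ι → ℝ}
    (hψ : ∀ i, IsCharacter (ψ i)) (hp0 : ∀ i, 0 ≤ p i) (hp : HasSum p 1)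
    (h : ∀ g, HasSum (fun i => (p i : ℂ) * ψ i g) (χ g)) : IsCharacter χ := by
  refine of_sum_nonneg (fun g g' => ?_) (fun g => ?_) (fun n g a => ?_) ?_
  · refine (h _).unique ?_
    simpa only [(hψ _).central g g'] using h (g' * g)
  · refine (h _).unique ?_
    simpa [(hψ _).map_inv] using (h g).star
  · have h1 := hasSum_sum (s := Finset.univ) fun i _ => hasSum_sum (s := Finset.univ) fun j _ =>
      ((h (g i * (g j)⁻¹)).mul_left (star (a i))).mul_right (a j)
    refine h1.nonneg fun k => ?_
    have h2 := mul_nonneg (Complex.zero_le_real.2 (hp0 k)) ((hψ k).sum_nonneg g a)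
    refine h2.trans_eq ?_
    simp only [Finset.mul_sum]
    exact Finset.sum_congr rfl fun i _ => Finset.sum_congr rfl fun j _ => by ring
  · refine (h 1).unique ?_
    simpa [(hψ _).map_one] using Complex.hasSum_ofReal.2 hp

end IsCharacter

/-- An indecomposable character which is a mixture of characters is one of them. -/
theorem IsIndecomposableCharacter.exists_eq_of_hasSum {G ι : Type*} [Group G] {χ : G → ℂ}
    (hχ : IsIndecomposableCharacter χ) {ψ : ι → G → ℂ} {p : ι → ℝ}
    (hψ : ∀ i, IsCharacter (ψ i)) (hp0 : ∀ i, 0 ≤ p i) (hp : HasSum p 1)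
    (h : ∀ g, HasSum (fun i => (p i : ℂ) * ψ i g) (χ g)) : ∃ i, χ = ψ i := by
  classical
  obtain ⟨i, hi⟩ : ∃ i, p i ≠ 0 := by
    by_contra! h0
    have : HasSum p 0 := by simp [funext h0]
    exact one_ne_zero (hp.unique this)
  have hi0 : 0 < p i := (hp0 i).lt_of_ne' hi
  have hi1 : p i ≤ 1 := by simpa using sum_le_hasSum {i} (fun j _ => hp0 j) hp
  have hq : HasSum (Function.update p i 0) (1 - p i) := by
    simpa [sub_eq_neg_add] using hp.update i 0
  have hq0 : ∀ j, 0 ≤ Function.update p i 0 j := fun j => by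
    by_cases hj : j = i
    · simp [hj]
    · simpa [hj] using hp0 j
  have hqψ : ∀ g, HasSum (fun j => (Function.update p i 0 j : ℂ) * ψ j g)
      (χ g - p i * ψ i g) := fun g => by
    have h1 := (h g).update i 0
    rw [zero_sub, neg_add_eq_sub] at h1
    refine h1.congr_fun fun j => ?_
    by_cases hj : j = i
    · simp [hj]
    · simp [hj]
  refine ⟨i, ?_⟩
  rcases hi1.eq_or_lt with h1 | h1
  · rw [h1, sub_self] at hq
    have hz : ∀ j, Function.update p i 0 j = 0 :=
      fun j => congrFun ((hasSum_zero_iff_of_nonneg hq0).1 hq) j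
    funext g
    have h2 := hqψ g
    simp only [hz, Complex.ofReal_zero, zero_mul, h1, Complex.ofReal_one, one_mul] at h2
    exact sub_eq_zero.1 (h2.unique hasSum_zero)
  · have hpos : 0 < 1 - p i := sub_pos.2 h1
    have hne : (1 - (p i : ℂ)) ≠ 0 := by exact_mod_cast hpos.ne'
    -- The renormalised mixture of the remaining terms; indecomposability forces it to equal `ψ i`.
    let χ' : G → ℂ := fun g => (1 - (p i : ℂ))⁻¹ * (χ g - p i * ψ i g)
    have hχ' : IsCharacter χ' := by
      refine IsCharacter.of_hasSum (p := fun j => (1 - p i)⁻¹ * Function.update p i 0 j) hψ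
        (fun j => mul_nonneg (inv_nonneg.2 hpos.le) (hq0 j)) ?_ fun g => ?_
      · simpa [inv_mul_cancel₀ hpos.ne'] using hq.mul_left (1 - p i)⁻¹
      · simpa [mul_assoc] using (hqψ g).mul_left (1 - (p i : ℂ))⁻¹
    have heq : ∀ g, χ g = (p i : ℂ) * ψ i g + (1 - (p i : ℂ)) * χ' g := fun g => by
      simp only [χ', mul_inv_cancel_left₀ hne]
      ring
    by_cases hd : ψ i = χ'
    · funext g
      rw [heq g, ← hd]
      ring
    · exact absurd ⟨p i, ψ i, χ', hi0, h1, hψ i, hχ', hd, heq⟩ hχ.2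

/-! ### The power characters: positivity, mixtures and uniqueness of weights -/

namespace CantorPerm

open Equiv

theorem fixRatio_le_one (g : SInf) : fixRatio g ≤ 1 := by
  have : MeasureTheory.IsProbabilityMeasure bernoulliMeasure := by
    unfold bernoulliMeasure; infer_instance
  exact MeasureTheory.measureReal_le_one

theorem fixRatio_mul_comm (g h : SInf) : fixRatio (g * h) = fixRatio (h * g) := by
  obtain ⟨n, hn⟩ := exists_toSInf_eq_of_finite ![g, h]
  obtain ⟨s, rfl : _ = g⟩ := hn 0
  obtain ⟨t, rfl : _ = h⟩ := hn 1
  rw [← map_mul, ← map_mul, fixRatio_toSInf, fixRatio_toSInf]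
  have h : t * s = t.permCongr (s * t) := by
    ext1 x
    simp
  rw [h, card_fixed_permCongr]

/-- The number of fixed points of `s i * (s j)⁻¹` is the inner product of the indicators of the
graphs of `(s i)⁻¹` and `(s j)⁻¹`; its `k`-th power is the inner product of their `k`-fold tensor
powers. -/
theorem isCharacter_pow (k : ℕ) : IsCharacter fun g : SInf => ((fixRatio g ^ k : ℝ) : ℂ) := by
  refine IsCharacter.of_sum_nonneg (fun g h => ?_) (fun g => ?_) (fun m g a => ?_) ?_
  · rw [fixRatio_mul_comm]
  · simp [fixRatio_inv]
  · obtain ⟨n, hn⟩ := exists_toSInf_eq_of_finite g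
    choose s hs using hn
    let V : Fin m → (Xn n × Xn n) → ℂ := fun i z => if (s i)⁻¹ z.1 = z.2 then 1 else 0
    have hV : ∀ i j, ((fixRatio (g i * (g j)⁻¹) ^ k : ℝ) : ℂ) =
        ((2 ^ n)⁻¹) ^ k * ∑ z : Fin k → Xn n × Xn n, (∏ l, V i (z l)) * ∏ l, V j (z l) := by
      intro i j
      have h1 : ((Finset.univ.filter fun x => (s i * (s j)⁻¹) x = x).card : ℂ) =
          ∑ z, V i z * V j z := by
        rw [Fintype.sum_prod_type, Finset.card_filter, Nat.cast_sum]
        refine Finset.sum_congr rfl fun x _ => ?_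
        have hiff : (s i * (s j)⁻¹) x = x ↔ (s j)⁻¹ x = (s i)⁻¹ x :=
          (Perm.eq_inv_iff_eq (f := s i) (x := (s j)⁻¹ x) (y := x)).symm
        simp only [V, hiff, ite_mul, one_mul, zero_mul, Finset.sum_ite_eq, Finset.mem_univ, if_true,
          Nat.cast_ite, Nat.cast_one, Nat.cast_zero]
      simp only [← Finset.prod_mul_distrib]
      rw [← Fintype.sum_pow fun z => V i z * V j z, ← h1, ← mul_pow, ← hs i, ← hs j, ← map_inv,
        ← map_mul, fixRatio_toSInf]
      push_cast
      rw [div_eq_inv_mul]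
    have hreal : ∀ i z, star (V i z) = V i z := fun i z => by
      simp only [V]; split_ifs <;> simp
    have key : ∑ i, ∑ j, star (a i) * ((fixRatio (g i * (g j)⁻¹) ^ k : ℝ) : ℂ) * a j =
        ((2 ^ n)⁻¹) ^ k * ∑ z : Fin k → Xn n × Xn n,
          star (∑ i, (∏ l, V i (z l)) * a i) * ∑ i, (∏ l, V i (z l)) * a i := by
      simp only [hV, star_sum, star_mul', star_prod, hreal, Finset.sum_mul_sum]
      simp only [Finset.mul_sum, Finset.sum_mul]
      rw [Finset.sum_comm (s := (Finset.univ : Finset (Fin k → Xn n × Xn n)))]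
      refine Finset.sum_congr rfl fun i _ => ?_
      rw [Finset.sum_comm]
      exact Finset.sum_congr rfl fun z _ => Finset.sum_congr rfl fun j _ => by ring
    rw [key]
    refine mul_nonneg (by positivity) (Finset.sum_nonneg fun z _ => star_mul_self_nonneg _)
  · simp [fixRatio_one]

/-- The function `s ↦ μ(Fix s) ^ α`. -/
def powChar (α : ℕ∞) (g : SInf) : ℂ := (epow (fixRatio g) α : ℝ)

theorem epow_natCast (x : ℝ) (k : ℕ) : epow x k = x ^ k := by simp [epow]

theorem epow_top (x : ℝ) : epow x ⊤ = if x = 1 then 1 else 0 := by simp [epow]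

theorem epow_one (α : ℕ∞) : epow 1 α = 1 := by
  induction α using ENat.recTopCoe with
  | top => simp [epow_top]
  | coe k => simp [epow_natCast]

theorem isCharacter_powChar (α : ℕ∞) : IsCharacter (powChar α) := by
  induction α using ENat.recTopCoe with
  | top =>
    refine IsCharacter.of_tendsto isCharacter_pow fun g => ?_
    refine (Complex.continuous_ofReal.tendsto _).comp ?_
    rw [epow_top]
    split_ifs with h
    · exact tendsto_const_nhds.congr fun k => by rw [h, one_pow]
    · exact tendsto_pow_atTop_nhds_zero_of_lt_one (fixRatio_nonneg g)
        ((fixRatio_le_one g).lt_of_ne h)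
  | coe k =>
    have h := isCharacter_pow k
    simp only [← epow_natCast] at h
    exact h

theorem hasSum_enat {M : Type*} [AddCommMonoid M] [TopologicalSpace M] [ContinuousAdd M]
    {F : ℕ∞ → M} {a : M} (h : HasSum (fun n : ℕ => F n) a) : HasSum F (a + F ⊤) := by
  have h1 : HasSum (fun α : ℕ∞ => if α = ⊤ then 0 else F α) a := by
    refine (Function.Injective.hasSum_iff (g := fun n : ℕ => (n : ℕ∞)) Nat.cast_injective ?_).1 ?_
    · intro α hα
      induction α using ENat.recTopCoe with
      | top => simp
      | coe k => exact absurd ⟨k, rfl⟩ hα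
    · simpa [Function.comp_def] using h
  convert h1.add (hasSum_ite_eq (⊤ : ℕ∞) (F ⊤)) using 2 with α
  split_ifs with hα <;> simp [hα]

/-- Every character is a mixture of the characters `powChar α`. -/
theorem exists_hasSum_powChar {χ : SInf → ℂ} (hχ : IsCharacter χ) :
    ∃ p : ℕ∞ → ℝ, (∀ α, 0 ≤ p α) ∧ HasSum p 1 ∧
      ∀ g, HasSum (fun α => (p α : ℂ) * powChar α g) (χ g) := by
  obtain ⟨p, hp0, hps, hp1, hp⟩ := exists_hasSum_pow hχ
  -- The escaped mass goes to `⊤`, whose character vanishes wherever the ratio is below `1`.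
  let q : ℕ∞ → ℝ := ENat.recTopCoe (1 - ∑' j, p j) p
  have hq : HasSum q 1 := by
    have h := hasSum_enat (F := q) (a := ∑' j, p j) hps.hasSum
    simpa [q] using h
  refine ⟨q, fun α => ?_, hq, fun g => ?_⟩
  · induction α using ENat.recTopCoe with
    | top => exact sub_nonneg.2 hp1
    | coe k => exact hp0 k
  · rcases (fixRatio_le_one g).eq_or_lt with h1 | h1
    · rw [apply_eq_of_fixRatio_eq hχ (h1.trans fixRatio_one.symm), hχ.map_one]
      simpa [powChar, h1, epow_one] using Complex.hasSum_ofReal.2 hq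
    · have h := hasSum_enat (F := fun α => (q α : ℂ) * powChar α g) (a := χ g) (by
        refine (hp g h1).congr_fun fun j => ?_
        simp [powChar, epow_natCast, q])
      simpa [powChar, epow_top, h1.ne] using h

/-- Translate every fibre except the one over a single point of `Xn i`. These ratios accumulate at
`0`, where weights are compared. -/
theorem exists_fixRatio_eq_pow (i : ℕ) : ∃ g, fixRatio g = (1 / 2) ^ i := by
  let e : ZMod 2 ≃ Xn 1 := Fintype.equivOfCardEq (by simp)
  refine ⟨prodAct i e (translate fun x => if x = fun _ => false then 0 else 1), ?_⟩
  rw [fixRatio_translate]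
  simp [Finset.filter_eq']

/-- For `α = ⊤` a sum of nonnegative terms is zero. For `α = m`, `q k * x ^ k ≤ x ^ m` kills the
weights with `k < m` as `x → 0`; then `x ^ m ≤ q m * x ^ m + x ^ (m + 1)` forces `q m ≥ 1`, leaving
nothing for the others, `⊤` included. -/
theorem weight_eq_zero {α : ℕ∞} {q : ℕ∞ → ℝ} (hq0 : ∀ β, 0 ≤ q β) (hq : HasSum q 1)
    (h : ∀ g, HasSum (fun β => q β * epow (fixRatio g) β) (epow (fixRatio g) α)) {β : ℕ∞}
    (hβ : β ≠ α) : q β = 0 := by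
  have hx : ∀ i : ℕ, HasSum (fun β => q β * epow ((1 / 2) ^ (i + 1)) β)
      (epow ((1 / 2) ^ (i + 1)) α) := fun i => by
    obtain ⟨g, hg⟩ := exists_fixRatio_eq_pow (i + 1)
    rw [← hg]
    exact h g
  have hlt : ∀ i : ℕ, ((1 / 2 : ℝ)) ^ (i + 1) < 1 := fun i =>
    pow_lt_one₀ (by norm_num) (by norm_num) (by omega)
  have htop : ∀ i : ℕ, epow ((1 / 2 : ℝ) ^ (i + 1)) ⊤ = 0 := fun i => by
    rw [epow_top, if_neg (hlt i).ne]
  have hnn : ∀ (i : ℕ) (β : ℕ∞), 0 ≤ epow ((1 / 2 : ℝ) ^ (i + 1)) β := fun i β => by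
    induction β using ENat.recTopCoe with
    | top => rw [htop]
    | coe k => rw [epow_natCast]; positivity
  have hlim : Tendsto (fun i : ℕ => ((1 / 2 : ℝ)) ^ (i + 1)) atTop (𝓝 0) :=
    (tendsto_pow_atTop_nhds_zero_of_lt_one (by norm_num) (by norm_num)).comp (tendsto_add_atTop_nat 1)
  induction α using ENat.recTopCoe with
  | top =>
    have h0 := hx 0
    rw [htop, hasSum_zero_iff_of_nonneg fun β => mul_nonneg (hq0 β) (hnn 0 β)] at h0
    induction β using ENat.recTopCoe with
    | top => exact absurd rfl hβ
    | coe k =>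
      have h1 := congrFun h0 (k : ℕ∞)
      rw [epow_natCast] at h1
      exact (mul_eq_zero.1 h1).resolve_right (by positivity)
  | coe m =>
    have hlow : ∀ k : ℕ, k < m → q k = 0 := fun k hk => by
      refine le_antisymm (ge_of_tendsto' hlim fun i => ?_) (hq0 _)
      have h1 := le_hasSum (hx i) (k : ℕ∞) fun β _ => mul_nonneg (hq0 β) (hnn i β)
      simp only [epow_natCast] at h1
      have hpos : 0 < ((1 / 2 : ℝ) ^ (i + 1)) := by positivity
      have h2 : ((1 / 2 : ℝ) ^ (i + 1)) ^ m ≤ ((1 / 2 : ℝ) ^ (i + 1)) ^ (k + 1) :=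
        pow_le_pow_of_le_one hpos.le (hlt i).le hk
      rw [pow_succ' _ k] at h2
      exact le_of_mul_le_mul_right (h1.trans h2) (by positivity)
    have hm : 1 ≤ q m := by
      have hl : Tendsto (fun i : ℕ => q m + ((1 / 2 : ℝ)) ^ (i + 1)) atTop (𝓝 (q m)) := by
        simpa using hlim.const_add (q m)
      refine ge_of_tendsto' hl fun i => ?_
      set x := (1 / 2 : ℝ) ^ (i + 1) with hxdef
      have hpos : 0 < x := by positivity
      have h1 := hasSum_le (f := fun β => q β * epow x β)
        (g := fun β => q β * x ^ (m + 1) + if β = m then q m * x ^ m else 0) (fun β => ?_) (hx i)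
        ((hq.mul_right (x ^ (m + 1))).add (hasSum_ite_eq (m : ℕ∞) (q m * x ^ m)))
      · rw [epow_natCast, one_mul, pow_succ' x m] at h1
        have h2 : 1 * x ^ m ≤ (q m + x) * x ^ m := by linarith
        exact le_of_mul_le_mul_right h2 (by positivity)
      · have hq1 : 0 ≤ q β * x ^ (m + 1) := mul_nonneg (hq0 β) (by positivity)
        induction β using ENat.recTopCoe with
        | top =>
          rw [htop, mul_zero]
          simpa using hq1
        | coe k =>
          rw [epow_natCast]
          rcases lt_trichotomy k m with hk | hk | hk
          · simp [hlow k hk, hk.ne]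
          · subst hk
            simpa using hq1
          · simp only [Nat.cast_inj, hk.ne', if_false, add_zero]
            exact mul_le_mul_of_nonneg_left (pow_le_pow_of_le_one hpos.le (hlt i).le hk) (hq0 _)
    have h1 := sum_le_hasSum {(m : ℕ∞), β} (fun β _ => hq0 β) hq
    rw [Finset.sum_pair hβ.symm] at h1
    exact le_antisymm (by linarith) (hq0 β)

/-- Expanding both summands as mixtures expands `powChar α` with the combined weights. These vanish
off `α`, hence so do the weights of each summand, and both summands equal `powChar α`. -/
theorem isIndecomposableCharacter_powChar (α : ℕ∞) : IsIndecomposableCharacter (powChar α) := by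
  refine ⟨isCharacter_powChar α, ?_⟩
  rintro ⟨t, χ₁, χ₂, ht0, ht1, h₁, h₂, hne, h⟩
  obtain ⟨p₁, hp₁, hs₁, hχ₁⟩ := exists_hasSum_powChar h₁
  obtain ⟨p₂, hp₂, hs₂, hχ₂⟩ := exists_hasSum_powChar h₂
  have ht1' : 0 < 1 - t := sub_pos.2 ht1
  have hz : ∀ β, β ≠ α → t * p₁ β + (1 - t) * p₂ β = 0 := fun β hβ => by
    refine weight_eq_zero (q := fun β => t * p₁ β + (1 - t) * p₂ β) (α := α)
      (fun β => add_nonneg (mul_nonneg ht0.le (hp₁ β)) (mul_nonneg ht1'.le (hp₂ β))) ?_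
      (fun g => ?_) hβ
    · simpa using (hs₁.mul_left t).add (hs₂.mul_left (1 - t))
    · have h1 := ((hχ₁ g).mul_left (t : ℂ)).add ((hχ₂ g).mul_left (1 - (t : ℂ)))
      rw [← h g] at h1
      refine Complex.hasSum_ofReal.1 (h1.congr_fun fun β => ?_)
      simp only [powChar]
      push_cast
      ring
  have huniq : ∀ (p : ℕ∞ → ℝ) (χ : SInf → ℂ), (∀ β, β ≠ α → p β = 0) → HasSum p 1 →
      (∀ g, HasSum (fun β => (p β : ℂ) * powChar β g) (χ g)) → χ = powChar α := by
    intro p χ hp hs hχ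
    have h1 : p α = 1 := (hasSum_single α hp).unique hs
    funext g
    refine (hχ g).unique ?_
    have h2 := hasSum_single (f := fun β => (p β : ℂ) * powChar β g) α fun β hβ => by simp [hp β hβ]
    simpa [h1] using h2
  refine hne ((huniq p₁ χ₁ (fun β hβ => ?_) hs₁ hχ₁).trans
    (huniq p₂ χ₂ (fun β hβ => ?_) hs₂ hχ₂).symm)
  · nlinarith [hz β hβ, hp₁ β, hp₂ β, mul_nonneg ht1'.le (hp₂ β), mul_nonneg ht0.le (hp₁ β)]
  · nlinarith [hz β hβ, hp₁ β, hp₂ β, mul_nonneg ht1'.le (hp₂ β), mul_nonneg ht0.le (hp₁ β)]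

end CantorPerm

end

theorem mainTheorem1 (χ : CantorPerm.SInf → ℂ) :
    IsIndecomposableCharacter χ ↔
      ∃ α : ℕ∞, ∀ s : CantorPerm.SInf,
        χ s = ((CantorPerm.epow
          (CantorPerm.bernoulliMeasure.real (CantorPerm.Fix (s : Equiv.Perm CantorPerm.X))) α : ℝ) :
            ℂ) := by
  constructor
  · intro hχ
    obtain ⟨p, hp0, hp, h⟩ := CantorPerm.exists_hasSum_powChar hχ.1
    obtain ⟨α, hα⟩ := hχ.exists_eq_of_hasSum CantorPerm.isCharacter_powChar hp0 hp h
    exact ⟨α, fun s => congrFun hα s⟩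
  · rintro ⟨α, hα⟩
    have h : χ = CantorPerm.powChar α := funext hα
    rw [h]
    exact CantorPerm.isIndecomposableCharacter_powChar α
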